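/- Let $(V,Y,\mathbf 1)$ be a vertex algebra over $\mathbb C$, with $Y(u,z)=\sum_{n\in\mathbb Z}u_nz^{-n-1}$, equipped with a $\mathbb C$-grading $V=\bigoplus_{\lambda\in\mathbb C}V_\lambda$ such that $\mathbf 1\in V_0$ and $v_nV_\lambda\subseteq V_{\lambda+\gamma-n-1}$ for $v\in V_\gamma$, $n\in\mathbb Z$; write $|v|=\gamma$ for $v\in V_\gamma$. Let $\Omega(V)$ be the set of $v\in V$ such that for all $\gamma\in\mathbb C$, $u\in V_\gamma$ and $n\in\mathbb Z$, $u_nv\neq0$ implies $n=\gamma-1$ or $n<\mathrm{Re}(\gamma)-1$. Assume that $V$ is an $\Omega$-generated $\mathbb C_{Re>0}$-graded vertex algebra, that is: (a) $V$ is spanned by the vectors $v^k_{n_k}\cdots v^1_{n_1}u^0$ with $k\ge 0$, $v^j\in V$, $n_j\in\mathbb Z$, $u^0\in\Omega(V)$; (b) the degree $\deg(v^k_{n_k}\cdots v^1_{n_1}u^0)=\sum_{j=1}^k(|v^j|-n_j-1)$ ($v^j$ homogeneous, $u^0\in\Omega(V)$) is well defined, that is, the subspaces $V(d)$, $d\in\mathbb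 C$, spanned by all such expressions with $\sum_j(|v^j|-n_j-1)=d$ are linearly independent. For $r\in\mathbb C$ let $V^r$ be the span of the homogeneous $v\in V$ with $|v|-\lceil\mathrm{Re}|v|\rceil=r$, so that $V^0$ is the integer-graded part of $V$. Assume that $V^0=\bigoplus_{n=0}^\infty V_n$. For homogeneous $u\in V^r$ and $v\in V$ put $$u\circ v=\mathrm{Res}_z\frac{(1+z)^{\lceil \mathrm{Re}|u|\rceil+\delta_{r,0}-1}}{z^{1+\delta_{r,0}}}Y(u,z)v,$$ extended linearly in $u$; let $O(V)$ be the span of all $u\circ v$, $u,v\in V$, and let $A(V)=V/O(V)$ (the Zhu algebra of $V$), with $[u]=u+O(V)$. For $t\geq -1$ let $F_tA(V)$ be the image of $\bigoplus_{j=0}^tV_j$ in $A(V)$ (so $F_{-1}A(V)=0$), and let $grA(V)=\bigoplus_{t\ge0}F_tA(V)/F_{t-1}A(V)$. Let $f:V\to grA(V)$ be the linear map with $f(u)=[u]+F_{k-1}A(V)$ for $u\in V_k$, $k\in\mathbb N$, and $f(u)=0$ for $u\in V_\lambda$, $\lambda\notin\mathbb N$. Finally let $$C(V)=\mathrm{Span}_{\mathbb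 C}\{a,\ u_{-2}v,\ b_{-1}w \mid a,b\in V^r \text{ with } r\neq0,\ u\in V^0,\ v,w\in V\}.$$ Then $f$ is surjective and $C(V)\subseteq\ker f$. Hence $f$ induces a linear epimorphism $\bar f:V/C(V)\to grA(V)$, and $\dim A(V)\le\dim V/C(V)$ (as cardinals). -/

import Mathlib

open scoped DirectSum

noncomputable section

/-- A vertex algebra over `ℂ` on the vector space `V`.  Mathlib's `VertexOperator ℂ V` is the space
of linear maps `V → V((x))`, so the lower truncation condition is part of the type of `Y`; the mode
`u_n`, the coefficient of `x^{-n-1}` in `Y(u, x)`, is `VertexOperator.ncoeff (Y u) n`. -/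
structure VertexAlgebra (V : Type*) [AddCommGroup V] [Module ℂ V] where
  /-- The state-field correspondence. -/
  Y : V →ₗ[ℂ] VertexOperator ℂ V
  /-- The vacuum vector. -/
  vac : V
  /-- `Y(𝟏, x)` is the identity. -/
  vacuum : ∀ (n : ℤ) (v : V),
    VertexOperator.ncoeff (Y vac) n v = if n = -1 then v else 0
  /-- `Y(v, x)𝟏` has no negative powers of `x`. -/
  creation_nonneg : ∀ (v : V) (n : ℤ), 0 ≤ n → VertexOperator.ncoeff (Y v) n vac = 0
  /-- The constant term of `Y(v, x)𝟏` is `v`. -/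
  creation_neg_one : ∀ v : V, VertexOperator.ncoeff (Y v) (-1) vac = v
  /-- The Jacobi identity: equality of the coefficients of `x₀^{-l-1} x₁^{-m-1} x₂^{-n-1}`,
  applied to `w`.  All sums are finite by lower truncation. -/
  jacobi : ∀ (u v w : V) (l m n : ℤ),
    (∑ᶠ i : ℕ, ((-1 : ℤ) ^ i * Ring.choose l i) •
        VertexOperator.ncoeff (Y u) (l + m - i) (VertexOperator.ncoeff (Y v) (n + i) w)) -
      (∑ᶠ i : ℕ, ((l.negOnePow : ℤ) * (-1 : ℤ) ^ i * Ring.choose l i) •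
        VertexOperator.ncoeff (Y v) (l + n - i) (VertexOperator.ncoeff (Y u) (m + i) w)) =
    ∑ᶠ i : ℕ, Ring.choose m i •
        VertexOperator.ncoeff (Y (VertexOperator.ncoeff (Y u) (l + i) v)) (m + n - i) w

/-- The mode `u_n` of a vertex algebra. -/
def VertexAlgebra.mode {V : Type*} [AddCommGroup V] [Module ℂ V] (A : VertexAlgebra V)
    (u : V) (n : ℤ) : Module.End ℂ V :=
  VertexOperator.ncoeff (A.Y u) n

/-- A `ℂ`-graded vertex algebra: `V = ⨁_{γ ∈ ℂ} V_γ` with `𝟏 ∈ V_0` and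
`v_n V_γ ⊆ V_{γ + |v| - n - 1}` for homogeneous `v`. -/
structure CGradedVertexAlgebra (V : Type*) [AddCommGroup V] [Module ℂ V] extends
    VertexAlgebra V where
  /-- `weight γ` is the homogeneous component `V_γ`. -/
  weight : ℂ → Submodule ℂ V
  isInternal : DirectSum.IsInternal weight
  vac_mem : vac ∈ weight 0
  mode_mem : ∀ (γ δ : ℂ) (v w : V) (n : ℤ), v ∈ weight γ → w ∈ weight δ →
    toVertexAlgebra.mode v n w ∈ weight (δ + γ - n - 1)

namespace CGradedVertexAlgebra

variable {V : Type*} [AddCommGroup V] [Module ℂ V] (A : CGradedVertexAlgebra V)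

/-- The linear isomorphism `V ≃ ⨁_γ V_γ`. -/
def decomp : V ≃ₗ[ℂ] ⨁ γ : ℂ, A.weight γ :=
  (LinearEquiv.ofBijective (DirectSum.coeLinearMap A.weight) A.isInternal).symm

/-- `Ω(V)`: the vectors killed by every mode `u_n`, `u ∈ V_γ`, except possibly those with
`n = γ - 1` or `n < Re γ - 1`. -/
def Omega : Set V :=
  {v | ∀ (γ : ℂ) (u : V) (n : ℤ), u ∈ A.weight γ → A.mode u n v ≠ 0 →
    (n : ℂ) = γ - 1 ∨ (n : ℝ) < γ.re - 1}

/-- Vectors of the form `v^k_{n_k} ⋯ v^1_{n_1} u⁰`, with `k ≥ 0` and `u⁰ ∈ Ω(V)`. -/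
inductive IsOmegaMonomial : V → Prop
  | base (u : V) (hu : u ∈ A.Omega) : IsOmegaMonomial u
  | step (v : V) (n : ℤ) (x : V) (hx : IsOmegaMonomial x) : IsOmegaMonomial (A.mode v n x)

/-- `V` is `Ω`-generated: every vector is a finite sum of vectors
`v^k_{n_k} ⋯ v^1_{n_1} u⁰`, `u⁰ ∈ Ω(V)`. -/
def IsOmegaGenerated : Prop :=
  Submodule.span ℂ {v | A.IsOmegaMonomial v} = ⊤

/-- `HasDegree d x`: `x = v^k_{n_k} ⋯ v^1_{n_1} u⁰` for some homogeneous `v^j` and some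
`u⁰ ∈ Ω(V)`, with `d = ∑_j (|v^j| - n_j - 1)`. -/
inductive HasDegree : ℂ → V → Prop
  | base (u : V) (hu : u ∈ A.Omega) : HasDegree 0 u
  | step (γ : ℂ) (v : V) (hv : v ∈ A.weight γ) (n : ℤ) (d : ℂ) (x : V) (hx : HasDegree d x) :
      HasDegree (d + (γ - n - 1)) (A.mode v n x)

/-- `V(d)`: the span of all expressions `v^k_{n_k} ⋯ v^1_{n_1} u⁰` of degree `d`. -/
def degreeSpace (d : ℂ) : Submodule ℂ V :=
  Submodule.span ℂ {x | A.HasDegree d x}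

/-- An `Ω`-generated `ℂ_{Re>0}`-graded vertex algebra: `V` is `Ω`-generated, and the degree is
well defined, that is, the spaces `V(d)` are linearly independent. -/
structure IsOmegaGeneratedRePos : Prop where
  generated : A.IsOmegaGenerated
  degree_wellDefined : iSupIndep A.degreeSpace

/-- `γ - ⌈Re γ⌉`, which is `0` if and only if `γ` is an integer. -/
def weightClass (γ : ℂ) : ℂ := γ - (⌈γ.re⌉ : ℤ)

/-- `V^r`: the span of the homogeneous vectors `v` with `|v| - ⌈Re |v|⌉ = r`. -/
def classSpace (r : ℂ) : Submodule ℂ V :=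
  Submodule.span ℂ {v | ∃ γ : ℂ, v ∈ A.weight γ ∧ weightClass γ = r}

/-- `Res_z (1+z)^N z^{-m} Y(u,z)v = ∑_{j ≥ 0} (N choose j) u_{j-m} v`, a finite sum. -/
def residue (N m : ℤ) (u v : V) : V :=
  ∑ᶠ j : ℕ, Ring.choose N j • A.mode u (j - m) v

open Classical in
/-- `δ_{r,0}` for `r` the class of `γ`. -/
def classDelta (γ : ℂ) : ℤ := if weightClass γ = 0 then 1 else 0

/-- `u ∘ v`, given for `u ∈ V_γ` by
`Res_z (1+z)^{⌈Re γ⌉ + δ_{r,0} - 1} z^{-1-δ_{r,0}} Y(u,z)v` and extended linearly in `u`. -/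
def circ (u v : V) : V :=
  ∑ᶠ γ : ℂ, A.residue (⌈γ.re⌉ + classDelta γ - 1) (1 + classDelta γ) (A.decomp u γ : V) v

/-- `O(V)`: the span of all `u ∘ v`. -/
def O : Submodule ℂ V :=
  Submodule.span ℂ {x | ∃ u v : V, x = A.circ u v}

/-- The vector space `A(V) = V / O(V)` underlying the Zhu algebra. -/
abbrev Zhu : Type _ := V ⧸ A.O

/-- `F_t A(V)`, the image of `⨁_{0 ≤ j ≤ t} V_j` in `A(V)`; it is zero for `t < 0`. -/
def filtration (t : ℤ) : Submodule ℂ A.Zhu :=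
  (⨆ (j : ℕ) (_ : (j : ℤ) ≤ t), A.weight (j : ℂ)).map A.O.mkQ

/-- `gr_t A(V) = F_t A(V) / F_{t-1} A(V)`. -/
abbrev gr (t : ℕ) : Type _ :=
  A.filtration t ⧸ (A.filtration ((t : ℤ) - 1)).submoduleOf (A.filtration t)

/-- `gr A(V) = ⨁_{t ≥ 0} gr_t A(V)`. -/
abbrev grZhu : Type _ := ⨁ t : ℕ, A.gr t

theorem mkQ_mem_filtration (k : ℕ) (u : V) (hu : u ∈ A.weight (k : ℂ)) :
    A.O.mkQ u ∈ A.filtration k :=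
  Submodule.mem_map_of_mem
    ((le_iSup₂_of_le (f := fun (j : ℕ) (_ : (j : ℤ) ≤ k) => A.weight (j : ℂ)) k le_rfl le_rfl) hu)

/-- The map `V_k → gr_k A(V)`, `u ↦ [u] + F_{k-1} A(V)`. -/
def symbol (k : ℕ) : A.weight (k : ℂ) →ₗ[ℂ] A.gr k :=
  ((A.filtration ((k : ℤ) - 1)).submoduleOf (A.filtration k)).mkQ ∘ₗ
    (A.O.mkQ ∘ₗ (A.weight (k : ℂ)).subtype).codRestrict (A.filtration k)
      (fun u => A.mkQ_mem_filtration k u u.2)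

open Classical in
/-- The restriction of `f` to `V_γ`: `u ↦ [u] + F_{k-1} A(V)` if `γ = k` is a natural number,
and zero otherwise. -/
def fWeight (γ : ℂ) : A.weight γ →ₗ[ℂ] A.grZhu :=
  if h : ∃ k : ℕ, γ = (k : ℂ) then
    DirectSum.lof ℂ ℕ A.gr h.choose ∘ₗ A.symbol h.choose ∘ₗ
      Submodule.inclusion (le_of_eq (congrArg A.weight h.choose_spec))
  else 0

/-- The natural linear map `f : V → gr A(V)`. -/
def f : V →ₗ[ℂ] A.grZhu :=
  DirectSum.toModule ℂ ℂ A.grZhu A.fWeight ∘ₗ A.decomp.toLinearMap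

/-- `C(V)`: the span of all `a`, `u_{-2} v` and `b_{-1} w` with `a, b ∈ V^r` for some `r ≠ 0`,
`u ∈ V^0` and `v, w ∈ V`. -/
def C : Submodule ℂ V :=
  Submodule.span ℂ
    ({a | ∃ r : ℂ, r ≠ 0 ∧ a ∈ A.classSpace r} ∪
      {x | ∃ u v : V, u ∈ A.classSpace 0 ∧ x = A.mode u (-2) v} ∪
      {x | ∃ (r : ℂ) (b w : V), r ≠ 0 ∧ b ∈ A.classSpace r ∧ x = A.mode b (-1) w})

end CGradedVertexAlgebra

end

/-!
Let `u`, `v` be homogeneous and `δ = δ_{r,0}` for the class `r` of `|u|`. The leading term of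
`u ∘ v` is `u_{-1-δ} v`, and all its other terms `u_n v`, `n > -1-δ`, have smaller weight. If these
weights are integers, then, as `V` has no negative integral weights, `[u_{-1-δ} v]` lies in the next
lower step of the filtration of `A(V)`; otherwise `f` kills every `u_n v`. So `f (u_{-1-δ} v) = 0`,
and for `δ = 1` and `δ = 0` these are the generators `u_{-2} v` and `b_{-1} w` of `C(V)`. Taking
`v = 𝟏` and `δ = 0` gives `u ∘ 𝟏 = u`, so vectors of non-integral weight die in `A(V)` and the
filtration exhausts `A(V)`. Splitting it over the field `ℂ` shows that `A(V)` is a quotient of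
`gr A(V)`, which gives the bound on dimensions.
-/

theorem finsum_sub_apply_mem {R M ι : Type*} [Ring R] [AddCommGroup M] [Module R M]
    (S : Submodule R M) {g : ι → M} (hg : g.support.Finite) (i₀ : ι)
    (h : ∀ i, i ≠ i₀ → g i ∈ S) : ∑ᶠ i, g i - g i₀ ∈ S := by
  rw [← S.ker_mkQ, LinearMap.sub_mem_ker_iff, map_finsum S.mkQ hg]
  exact finsum_eq_single _ i₀ fun i hi => (Submodule.Quotient.mk_eq_zero S).2 (h i hi)

section Filtration

variable {K M : Type*} [DivisionRing K] [AddCommGroup M] [Module K M]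

theorem exists_linearMap_le_sup_range (P Q : Submodule K M) :
    ∃ s : (Q ⧸ P.submoduleOf Q) →ₗ[K] M, Q ≤ P ⊔ LinearMap.range s := by
  obtain ⟨s, hs⟩ := (P.submoduleOf Q).mkQ.exists_rightInverse_of_surjective
    (P.submoduleOf Q).range_mkQ
  refine ⟨Q.subtype ∘ₗ s, fun x hx => ?_⟩
  let y : Q ⧸ P.submoduleOf Q := Submodule.Quotient.mk ⟨x, hx⟩
  have hdiff : x - (s y : M) ∈ P :=
    (Submodule.Quotient.eq (P.submoduleOf Q)).1 (LinearMap.congr_fun hs y).symm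
  exact Submodule.mem_sup.2 ⟨_, hdiff, s y, ⟨y, rfl⟩, sub_add_cancel _ _⟩

theorem exists_surjective_of_filtration {F : ℤ → Submodule K M} (hbot : F (-1) = ⊥)
    (htop : ⨆ t : ℕ, F t = ⊤) :
    ∃ g : (⨁ t : ℕ, F t ⧸ (F ((t : ℤ) - 1)).submoduleOf (F t)) →ₗ[K] M,
      Function.Surjective g := by
  choose s hs using fun t : ℕ => exists_linearMap_le_sup_range (F ((t : ℤ) - 1)) (F t)
  let g := DirectSum.toModule K ℕ M s
  have range_le (t : ℕ) : LinearMap.range (s t) ≤ LinearMap.range g := by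
    rintro _ ⟨y, rfl⟩
    exact ⟨DirectSum.lof K ℕ _ t y, DirectSum.toModule_lof (φ := s) K t y⟩
  have le_range (t : ℕ) : F t ≤ LinearMap.range g := by
    induction t with
    | zero => exact (hs 0).trans (sup_le (by simp [hbot]) (range_le 0))
    | succ t ih => exact (hs (t + 1)).trans (sup_le (by simpa using ih) (range_le (t + 1)))
  refine ⟨g, LinearMap.range_eq_top.1 (eq_top_iff.2 ?_)⟩
  exact htop ▸ iSup_le le_range

end Filtration

namespace CGradedVertexAlgebra

variable {V : Type*} [AddCommGroup V] [Module ℂ V] (A : CGradedVertexAlgebra V)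

theorem weightClass_eq_zero_iff {γ : ℂ} : weightClass γ = 0 ↔ ∃ m : ℤ, γ = m := by
  refine ⟨fun h => ⟨⌈γ.re⌉, sub_eq_zero.1 h⟩, ?_⟩
  rintro ⟨m, rfl⟩
  simp [weightClass]

theorem classDelta_of_eq_zero {γ : ℂ} (hγ : weightClass γ = 0) : classDelta γ = 1 :=
  if_pos hγ

theorem classDelta_of_ne_zero {γ : ℂ} (hγ : weightClass γ ≠ 0) : classDelta γ = 0 :=
  if_neg hγ

theorem weight_le_classSpace (γ : ℂ) : A.weight γ ≤ A.classSpace (weightClass γ) :=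
  fun _ hv => Submodule.subset_span ⟨γ, hv, rfl⟩

theorem classSpace_le_iff {r : ℂ} {S : Submodule ℂ V} :
    A.classSpace r ≤ S ↔ ∀ γ, weightClass γ = r → A.weight γ ≤ S := by
  refine ⟨?_, fun h => Submodule.span_le.2 fun _ ⟨γ, hv, hγ⟩ => h γ hγ hv⟩
  rintro h γ rfl
  exact (A.weight_le_classSpace γ).trans h

theorem eq_top_of_weight_le {S : Submodule ℂ V} (h : ∀ γ, A.weight γ ≤ S) : S = ⊤ :=
  eq_top_iff.2 (A.isInternal.submodule_iSup_eq_top ▸ iSup_le h)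

theorem weight_intCast_eq_bot (h0 : A.classSpace 0 ≤ ⨆ n : ℕ, A.weight (n : ℂ)) (m : ℤ)
    (hm : m < 0) : A.weight (m : ℂ) = ⊥ := by
  have hle_nat : A.weight (m : ℂ) ≤ ⨆ n : ℕ, A.weight (n : ℂ) :=
    (A.classSpace_le_iff.1 h0) m (weightClass_eq_zero_iff.2 ⟨m, rfl⟩)
  have hle_ne : ⨆ n : ℕ, A.weight (n : ℂ) ≤ ⨆ (γ : ℂ) (_ : γ ≠ m), A.weight γ := by
    refine iSup_le fun n => le_iSup₂_of_le (n : ℂ) (fun h => ?_) le_rfl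
    have : (n : ℤ) = m := by exact_mod_cast h
    omega
  exact (A.isInternal.submodule_iSupIndep (m : ℂ)).eq_bot_of_le (hle_nat.trans hle_ne)

theorem decomp_of_mem {γ : ℂ} {u : V} (hu : u ∈ A.weight γ) :
    A.decomp u = DirectSum.lof ℂ ℂ (fun γ => A.weight γ) γ ⟨u, hu⟩ := by
  rw [decomp, LinearEquiv.symm_apply_eq]
  exact (DirectSum.coeLinearMap_lof A.weight γ ⟨u, hu⟩).symm

theorem fWeight_natCast (k : ℕ) (u : A.weight (k : ℂ)) :
    A.fWeight k u = DirectSum.lof ℂ ℕ A.gr k (A.symbol k u) := by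
  have h : ∃ j : ℕ, (k : ℂ) = j := ⟨k, rfl⟩
  -- `fWeight` picks the natural number by choice, so the identification is generalized over it.
  have transport (j : ℕ) (hj : (k : ℂ) = j) :
      DirectSum.lof ℂ ℕ A.gr j (A.symbol j (Submodule.inclusion (congrArg A.weight hj).le u)) =
        DirectSum.lof ℂ ℕ A.gr k (A.symbol k u) := by
    obtain rfl : k = j := by exact_mod_cast hj
    rfl
  rw [fWeight, dif_pos h]
  exact transport _ h.choose_spec

theorem f_of_mem_weight {γ : ℂ} {u : V} (hu : u ∈ A.weight γ) :
    A.f u = A.fWeight γ ⟨u, hu⟩ := by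
  rw [f, LinearMap.comp_apply, LinearEquiv.coe_coe, A.decomp_of_mem hu, DirectSum.toModule_lof]

theorem f_eq_zero_of_forall_ne_natCast {γ : ℂ} (hγ : ∀ k : ℕ, γ ≠ k) {u : V}
    (hu : u ∈ A.weight γ) : A.f u = 0 := by
  rw [A.f_of_mem_weight hu, fWeight, dif_neg (not_exists.2 hγ), LinearMap.zero_apply]

theorem f_eq_zero_of_mkQ_mem_filtration {k : ℕ} {u : V} (hu : u ∈ A.weight (k : ℂ))
    (h : A.O.mkQ u ∈ A.filtration ((k : ℤ) - 1)) : A.f u = 0 := by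
  have hsymbol : A.symbol k ⟨u, hu⟩ = 0 := (Submodule.Quotient.mk_eq_zero _).2 h
  rw [A.f_of_mem_weight hu, fWeight_natCast, hsymbol, map_zero]

/-- `⨁_{0 ≤ j ≤ t} V_j`, whose image in `A(V)` is `F_t A(V)`; it is zero for `t < 0`. -/
def weightLE (t : ℤ) : Submodule ℂ V := ⨆ (j : ℕ) (_ : (j : ℤ) ≤ t), A.weight (j : ℂ)

theorem weight_natCast_le_weightLE {j : ℕ} {t : ℤ} (hj : (j : ℤ) ≤ t) :
    A.weight (j : ℂ) ≤ A.weightLE t :=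
  le_iSup₂_of_le (f := fun (j : ℕ) (_ : (j : ℤ) ≤ t) => A.weight (j : ℂ)) j hj le_rfl

theorem weightLE_natCast_le_sup (k : ℕ) :
    A.weightLE k ≤ A.weight (k : ℂ) ⊔ A.weightLE ((k : ℤ) - 1) := by
  refine iSup₂_le fun j hj => ?_
  obtain rfl | hlt := eq_or_lt_of_le (Int.ofNat_le.1 hj)
  · exact le_sup_left
  · exact le_sup_of_le_right (A.weight_natCast_le_weightLE (by omega))

theorem filtration_eq_map (t : ℤ) : A.filtration t = (A.weightLE t).map A.O.mkQ := rfl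

theorem filtration_neg_one : A.filtration (-1) = ⊥ := by
  have hbot : A.weightLE (-1) = ⊥ := eq_bot_iff.2 (iSup₂_le fun j hj => by omega)
  rw [filtration_eq_map, hbot, Submodule.map_bot]

theorem symbol_surjective (k : ℕ) : Function.Surjective (A.symbol k) := by
  intro y
  obtain ⟨⟨_, ⟨x, hx, rfl⟩⟩, rfl⟩ := Submodule.mkQ_surjective _ y
  obtain ⟨u, hu, z, hz, rfl⟩ := Submodule.mem_sup.1 (A.weightLE_natCast_le_sup k hx)
  refine ⟨⟨u, hu⟩, ((Submodule.Quotient.eq _).2 ?_).symm⟩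
  change A.O.mkQ (u + z) - A.O.mkQ u ∈ A.filtration ((k : ℤ) - 1)
  rw [map_add, add_sub_cancel_left]
  exact Submodule.mem_map_of_mem hz

theorem f_surjective : Function.Surjective A.f := by
  intro x
  induction x using DirectSum.induction_on with
  | zero => exact ⟨0, map_zero _⟩
  | of k y =>
    obtain ⟨u, rfl⟩ := A.symbol_surjective k y
    exact ⟨u, (A.f_of_mem_weight u.2).trans (A.fWeight_natCast k u)⟩
  | add x y hx hy =>
    obtain ⟨u, rfl⟩ := hx
    obtain ⟨v, rfl⟩ := hy
    exact ⟨u + v, map_add _ _ _⟩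

/-- The mode product `u ↦ u_n v` as a linear map in `u`, for fixed `n` and `v`. -/
def modeLeft (n : ℤ) (v : V) : V →ₗ[ℂ] V :=
  LinearMap.applyₗ v ∘ₗ LinearMap.proj n ∘ₗ VertexOperator.ncoeff ∘ₗ A.Y

theorem modeLeft_apply (n : ℤ) (u v : V) : A.modeLeft n v u = A.mode u n v := rfl

theorem eventually_mode_eq_zero (u v : V) : ∀ᶠ n : ℤ in Filter.atTop, A.mode u n v = 0 := by
  filter_upwards [Filter.eventually_ge_atTop
    (-HahnSeries.order ((HahnModule.of ℂ).symm (A.Y u v)))] with n hn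
  exact VertexOperator.ncoeff_eq_zero_of_lt_order _ _ _ (by omega)

theorem residue_support_finite (N m : ℤ) (u v : V) :
    (Function.support fun j : ℕ => Ring.choose N j • A.mode u (j - m) v).Finite := by
  have htendsto : Filter.Tendsto (fun j : ℕ => (j : ℤ) - m) Filter.atTop Filter.atTop :=
    Filter.tendsto_atTop_add_const_right _ (-m) tendsto_natCast_atTop_atTop
  have hzero := htendsto.eventually (A.eventually_mode_eq_zero u v)
  rw [← Nat.cofinite_eq_atTop, Filter.eventually_cofinite] at hzero
  exact hzero.subset fun j hj h => hj (by simp only [h, smul_zero])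

theorem residue_sub_mode_mem {S : Submodule ℂ V} (N : ℤ) {m : ℤ} {u v : V}
    (hS : ∀ n : ℤ, -m < n → A.mode u n v ∈ S) :
    A.residue N m u v - A.mode u (-m) v ∈ S := by
  have h := finsum_sub_apply_mem S (A.residue_support_finite N m u v) 0 fun j hj =>
    zsmul_mem (hS _ (by omega)) _
  simpa only [residue, Ring.choose_zero_right, one_smul, Nat.cast_zero, zero_sub] using h

theorem circ_of_mem_weight {γ : ℂ} {u : V} (hu : u ∈ A.weight γ) (v : V) :
    A.circ u v = A.residue (⌈γ.re⌉ + classDelta γ - 1) (1 + classDelta γ) u v := by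
  rw [circ, finsum_eq_single _ γ, A.decomp_of_mem hu, DirectSum.lof_apply]
  intro δ hδ
  rw [A.decomp_of_mem hu, DirectSum.lof_eq_of, DirectSum.of_eq_of_ne _ _ _ hδ]
  simp [residue, ← modeLeft_apply]

theorem circ_mem_O (u v : V) : A.circ u v ∈ A.O :=
  Submodule.subset_span ⟨u, v, rfl⟩

theorem circ_sub_mode_mem {S : Submodule ℂ V} {γ : ℂ} {u v : V} (hu : u ∈ A.weight γ)
    (hS : ∀ n : ℤ, -(1 + classDelta γ) < n → A.mode u n v ∈ S) :
    A.circ u v - A.mode u (-(1 + classDelta γ)) v ∈ S :=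
  A.circ_of_mem_weight hu v ▸ A.residue_sub_mode_mem _ hS

theorem circ_vac {γ : ℂ} (hγ : weightClass γ ≠ 0) {u : V} (hu : u ∈ A.weight γ) :
    A.circ u A.vac = u := by
  have h := A.circ_sub_mode_mem (S := ⊥) (v := A.vac) hu fun n hn =>
    (Submodule.mem_bot ℂ).2 (A.creation_nonneg u n (by rw [classDelta_of_ne_zero hγ] at hn; omega))
  rw [Submodule.mem_bot, sub_eq_zero, classDelta_of_ne_zero hγ] at h
  exact h.trans (A.creation_neg_one u)

theorem weight_le_O {γ : ℂ} (hγ : weightClass γ ≠ 0) : A.weight γ ≤ A.O :=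
  fun u hu => A.circ_vac hγ hu ▸ A.circ_mem_O u A.vac

section NonnegativeIntegralWeights

variable (hneg : ∀ m : ℤ, m < 0 → A.weight (m : ℂ) = ⊥)
include hneg

theorem weight_intCast_le_weightLE {m t : ℤ} (hmt : m ≤ t) :
    A.weight (m : ℂ) ≤ A.weightLE t := by
  obtain hm | hm := lt_or_ge m 0
  · exact hneg m hm ▸ bot_le
  · lift m to ℕ using hm
    exact_mod_cast A.weight_natCast_le_weightLE hmt

theorem iSup_filtration : ⨆ t : ℕ, A.filtration t = ⊤ := by
  simp only [filtration_eq_map, ← Submodule.map_iSup]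
  rw [Submodule.map_mkQ_eq_top]
  refine A.eq_top_of_weight_le fun γ => ?_
  by_cases hγ : weightClass γ = 0
  · obtain ⟨m, rfl⟩ := weightClass_eq_zero_iff.1 hγ
    exact le_sup_of_le_right (le_iSup_of_le m.toNat
      (A.weight_intCast_le_weightLE hneg m.self_le_toNat))
  · exact le_sup_of_le_left (A.weight_le_O hγ)

theorem rank_Zhu_le_rank_grZhu : Module.rank ℂ A.Zhu ≤ Module.rank ℂ A.grZhu := by
  obtain ⟨g, hg⟩ := exists_surjective_of_filtration A.filtration_neg_one (A.iSup_filtration hneg)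
  exact LinearMap.rank_le_of_surjective g hg

theorem mkQ_mode_mem_filtration {γ δ : ℂ} {u v : V} (hu : u ∈ A.weight γ)
    (hv : v ∈ A.weight δ) {k : ℤ} (hk : δ + γ - (-(1 + classDelta γ) : ℤ) - 1 = k) :
    A.O.mkQ (A.mode u (-(1 + classDelta γ)) v) ∈ A.filtration (k - 1) := by
  have hlower : A.circ u v - A.mode u (-(1 + classDelta γ)) v ∈ A.weightLE (k - 1) := by
    refine A.circ_sub_mode_mem hu fun n hn => ?_
    have hweight : δ + γ - n - 1 = (k - (1 + classDelta γ) - n : ℤ) := by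
      push_cast at hk ⊢
      linear_combination hk
    exact A.weight_intCast_le_weightLE hneg (by omega) (hweight ▸ A.mode_mem γ δ u v n hu hv)
  have hcirc : A.O.mkQ (A.circ u v) = 0 :=
    (Submodule.Quotient.mk_eq_zero A.O).2 (A.circ_mem_O u v)
  have hclass := Submodule.mem_map_of_mem (f := A.O.mkQ) hlower
  rwa [map_sub, hcirc, zero_sub, neg_mem_iff] at hclass

theorem f_mode_eq_zero {γ : ℂ} {u : V} (hu : u ∈ A.weight γ) (v : V) :
    A.f (A.mode u (-(1 + classDelta γ)) v) = 0 := by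
  suffices h : LinearMap.ker (A.f ∘ₗ A.mode u (-(1 + classDelta γ))) = ⊤ from
    LinearMap.congr_fun (LinearMap.ker_eq_top.1 h) v
  refine A.eq_top_of_weight_le fun δ v hv => ?_
  have hmem := A.mode_mem γ δ u v (-(1 + classDelta γ)) hu hv
  by_cases hk : ∃ k : ℕ, δ + γ - (-(1 + classDelta γ) : ℤ) - 1 = k
  · obtain ⟨k, hk⟩ := hk
    exact A.f_eq_zero_of_mkQ_mem_filtration (hk ▸ hmem)
      (A.mkQ_mode_mem_filtration hneg hu hv (by exact_mod_cast hk))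
  · exact A.f_eq_zero_of_forall_ne_natCast (not_exists.1 hk) hmem

theorem C_le_ker_f : A.C ≤ LinearMap.ker A.f := by
  refine Submodule.span_le.2 (Set.union_subset (Set.union_subset ?_ ?_) ?_)
  · rintro a ⟨r, hr, ha⟩
    refine A.classSpace_le_iff.2 (fun γ hγ a ha => ?_) ha
    refine A.f_eq_zero_of_forall_ne_natCast (fun k hk => hr ?_) ha
    exact hγ ▸ weightClass_eq_zero_iff.2 ⟨k, by simpa using hk⟩
  · rintro _ ⟨u, v, hu, rfl⟩
    have hle : A.classSpace 0 ≤ LinearMap.ker (A.f ∘ₗ A.modeLeft (-2) v) :=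
      A.classSpace_le_iff.2 fun γ hγ u hu => by
        simpa [modeLeft_apply, classDelta_of_eq_zero hγ] using A.f_mode_eq_zero hneg hu v
    exact hle hu
  · rintro _ ⟨r, b, w, hr, hb, rfl⟩
    have hle : A.classSpace r ≤ LinearMap.ker (A.f ∘ₗ A.modeLeft (-1) w) :=
      A.classSpace_le_iff.2 fun γ hγ b hb => by
        simpa [modeLeft_apply, classDelta_of_ne_zero (hγ ▸ hr)] using A.f_mode_eq_zero hneg hb w
    exact hle hb

end NonnegativeIntegralWeights

end CGradedVertexAlgebra

theorem theorem5p3_general {V : Type*} [AddCommGroup V] [Module ℂ V] (A : CGradedVertexAlgebra V)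
    (h0 : A.classSpace 0 = ⨆ n : ℕ, A.weight (n : ℂ)) :
    Function.Surjective A.f ∧
      A.C ≤ LinearMap.ker A.f ∧
      (∃ fbar : (V ⧸ A.C) →ₗ[ℂ] A.grZhu,
        fbar ∘ₗ A.C.mkQ = A.f ∧ Function.Surjective fbar) ∧
      Module.rank ℂ A.Zhu ≤ Module.rank ℂ (V ⧸ A.C) := by
  have hneg := A.weight_intCast_eq_bot h0.le
  have hC : A.C ≤ LinearMap.ker A.f := A.C_le_ker_f hneg
  -- `liftQ` needs an additive group; instance search only finds a monoid structure on `gr A(V)`.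
  let : AddCommGroup A.grZhu := Module.addCommMonoidToAddCommGroup ℂ
  let fbar : (V ⧸ A.C) →ₗ[ℂ] A.grZhu := A.C.liftQ A.f hC
  have hcomp : fbar ∘ₗ A.C.mkQ = A.f := A.C.liftQ_mkQ A.f hC
  have hfbar : Function.Surjective fbar :=
    Function.Surjective.of_comp (g := A.C.mkQ) (by
      rw [← LinearMap.coe_comp, hcomp]; exact A.f_surjective)
  have hrank : Module.rank ℂ A.Zhu ≤ Module.rank ℂ (V ⧸ A.C) :=
    (A.rank_Zhu_le_rank_grZhu hneg).trans (LinearMap.rank_le_of_surjective fbar hfbar)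
  exact ⟨A.f_surjective, hC, ⟨fbar, hcomp, hfbar⟩, hrank⟩

theorem theorem5p3 {V : Type*} [AddCommGroup V] [Module ℂ V] (A : CGradedVertexAlgebra V)
    (hA : A.IsOmegaGeneratedRePos)
    (h0 : A.classSpace 0 = ⨆ n : ℕ, A.weight (n : ℂ)) :
    Function.Surjective A.f ∧
      A.C ≤ LinearMap.ker A.f ∧
      (∃ fbar : (V ⧸ A.C) →ₗ[ℂ] A.grZhu,
        fbar ∘ₗ A.C.mkQ = A.f ∧ Function.Surjective fbar) ∧
      Module.rank ℂ A.Zhu ≤ Module.rank ℂ (V ⧸ A.C) :=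
  theorem5p3_general A h0
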